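/- **Proposition (the subsystem $H_3$ is passive).** Let $m,d\in\mathbb N$, let node $j\in\{1,\dots,m\}$ hold $n_j$ labelled samples $(x_{ji},y_{ji})\in\mathbb R^d\times\{-1,1\}$, let $C>0$, and put $h_{ji}=1-\xi_{ji}-y_{ji}(w_j^Tx_{ji}+b_j)$ and $g_{ji}=-mC-\mu_{ji}+\theta_{ji}$. For real $p,z$ let $[p]^+_z=p$ if $z>0$ or $p>0$, and $[p]^+_z=0$ otherwise. The subsystem $H_3$ has input $u_{H_3}=(w,b)$, with $w_j\in\mathbb R^d$, $b_j\in\mathbb R$, state $(\theta,\mu,\xi)$, dynamics $$\dot\theta_{ji}=[h_{ji}]^+_{\theta_{ji}},\qquad \dot\mu_{ji}=[\xi_{ji}]^+_{\mu_{ji}},\qquad \dot\xi_{ji}=[g_{ji}]^+_{\xi_{ji}},\qquad 1\le i\le n_j,\ 1\le j\le m,$$ and output $y_{H_3}=(\zeta,\eta)$ with $\zeta_j=\sum_i\theta_{ji}(-y_{ji}x_{ji})$, $\eta_j=\sum_i\theta_{ji}(-y_{ji})$. The projection is active on the index sets $$\sigma_j=\{i:\theta_{ji}=0,\ h_{ji}\le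 0\},\quad \iota_j=\{i:\mu_{ji}=0,\ \xi_{ji}\le 0\},\quad \rho_j=\{i:\xi_{ji}=0,\ g_{ji}\le 0\},$$ which are regarded as switching signals in time; a switching instant of such a signal is a time $\tau\ge0$ such that the signal is not constant on any neighbourhood of $\tau$ in $[0,\infty)$. Define the Krasovskii storage function $$V_{H_3}=\frac12\sum_{j=1}^m\Big(\sum_{i\notin\sigma_j}\dot\theta_{ji}^2+\sum_{i\notin\iota_j}\dot\mu_{ji}^2+\sum_{i\notin\rho_j}\dot\xi_{ji}^2\Big),$$ where the velocities stand for the right-hand sides of the dynamics. Let the input $(w,b)$ be locally absolutely continuous on $[0,\infty)$, and let $(\theta,\mu,\xi)$ be any Carathéodory solution of $H_3$ on $[0,\infty)$ (locally absolutely continuous, satisfying the equations almost everywhere) with nonnegative initial value. Write $V(t)$ for the value of $V_{H_3}$ along this trajectory. Then $V\ge0$, and: 1. $H_3$ is passive with port input $\dot u_{H_3}=(\dot w,\dot b)$ and port output $\dot y_{H_3}=(\dot\zeta,\dot\eta)$ between each pair of switching instants $\tau_1<\tau_2$ of $\sigma$, each such pair of $\iota$, and each such pair of $\rho$: the function $\dot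 y_{H_3}^T\dot u_{H_3}$ is integrable on $[\tau_1,\tau_2]$ and $$V(t_1)-V(t_0)\le\int_{t_0}^{t_1}\dot y_{H_3}^T\dot u_{H_3}\,dt\qquad\text{for all }\tau_1\le t_0\le t_1\le\tau_2 .$$ The same holds on every interval $[0,T]$. 2. The storage function does not increase at switching events: $V$ is right-continuous on $[0,\infty)$, and at every $\tau>0$ the left limit $V(\tau^-)$ exists and $V(\tau^+)=V(\tau)\le V(\tau^-)$. -/

import Mathlib

open MeasureTheory Filter Topology Set

noncomputable section

namespace DSVM

/-- Data of a distributed support vector machine on `m` nodes with feature dimension `d`: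
node `j` stores `n j` labelled observations `(x j i, y j i)`, and `C` is the trade-off constant. -/
structure Data (m d : ℕ) (n : Fin m → ℕ) where
  C : ℝ
  C_pos : 0 < C
  x : ∀ j : Fin m, Fin (n j) → EuclideanSpace ℝ (Fin d)
  y : ∀ j : Fin m, Fin (n j) → ℝ
  y_label : ∀ j i, y j i = 1 ∨ y j i = -1

/-- A value of the port variables: one weight-like vector and one bias-like number per node.
The input `(w, b)` and the output `(ζ, η)` of `H₃` are of this kind. -/
structure Port (m d : ℕ) where
  weight : Fin m → EuclideanSpace ℝ (Fin d)
  bias : Fin m → ℝ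

/-- A state of `H₃`: the multipliers `θ`, `μ` and the slacks `ξ`. -/
structure State (m : ℕ) (n : Fin m → ℕ) where
  θ : ∀ j : Fin m, Fin (n j) → ℝ
  μ : ∀ j : Fin m, Fin (n j) → ℝ
  ξ : ∀ j : Fin m, Fin (n j) → ℝ

/-- The projection `[p]⁺_z`: it is `p` if `z > 0` or `p > 0`, and `0` otherwise. -/
def posProj (p z : ℝ) : ℝ :=
  open Classical in if 0 < z ∨ 0 < p then p else 0

variable {m d : ℕ} {n : Fin m → ℕ}

namespace Data

/-- `h_ji(ξ_ji, w_j, b_j) = 1 - ξ_ji - y_ji (w_jᵀ x_ji + b_j)`. -/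
def h (D : Data m d n) (u : Port m d) (s : State m n) (j : Fin m) (i : Fin (n j)) : ℝ :=
  1 - s.ξ j i - D.y j i * (inner ℝ (u.weight j) (D.x j i) + u.bias j)

/-- The unprojected velocity `-mC - μ_ji + θ_ji` of the slack `ξ_ji`. -/
def g (D : Data m d n) (s : State m n) (j : Fin m) (i : Fin (n j)) : ℝ :=
  -((m : ℝ) * D.C) - s.μ j i + s.θ j i

/-- Right-hand side of the equation for `θ_ji`. -/
def thetaDot (D : Data m d n) (u : Port m d) (s : State m n) (j : Fin m) (i : Fin (n j)) : ℝ :=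
  posProj (D.h u s j i) (s.θ j i)

/-- Right-hand side of the equation for `μ_ji`. -/
def muDot (_D : Data m d n) (s : State m n) (j : Fin m) (i : Fin (n j)) : ℝ :=
  posProj (s.ξ j i) (s.μ j i)

/-- Right-hand side of the equation for `ξ_ji`. -/
def xiDot (D : Data m d n) (s : State m n) (j : Fin m) (i : Fin (n j)) : ℝ :=
  posProj (D.g s j i) (s.ξ j i)

/-- `σ_j`: the indices at which the projection in the `θ`-equation is active. -/
def sigma (D : Data m d n) (u : Port m d) (s : State m n) (j : Fin m) : Finset (Fin (n j)) :=
  open Classical in {i | s.θ j i = 0 ∧ D.h u s j i ≤ 0}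

/-- `ι_j`: the indices at which the projection in the `μ`-equation is active. -/
def iota (_D : Data m d n) (s : State m n) (j : Fin m) : Finset (Fin (n j)) :=
  open Classical in {i | s.μ j i = 0 ∧ s.ξ j i ≤ 0}

/-- `ρ_j`: the indices at which the projection in the `ξ`-equation is active. -/
def rho (D : Data m d n) (s : State m n) (j : Fin m) : Finset (Fin (n j)) :=
  open Classical in {i | s.ξ j i = 0 ∧ D.g s j i ≤ 0}

/-- The output `(ζ, η)`, with `ζ_j = ∑ᵢ θ_ji (-y_ji x_ji)` and `η_j = ∑ᵢ θ_ji (-y_ji)`. -/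
def output (D : Data m d n) (s : State m n) : Port m d where
  weight j := ∑ i, s.θ j i • (-(D.y j i • D.x j i))
  bias j := ∑ i, s.θ j i * (-D.y j i)

/-- The Krasovskii storage function: half the sum of the squared velocities over the
constraints whose projection is not active. -/
def storage (D : Data m d n) (u : Port m d) (s : State m n) : ℝ :=
  (1 / 2) * ∑ j, (∑ i ∈ (D.sigma u s j)ᶜ, D.thetaDot u s j i ^ 2
    + ∑ i ∈ (D.iota s j)ᶜ, D.muDot s j i ^ 2
    + ∑ i ∈ (D.rho s j)ᶜ, D.xiDot s j i ^ 2)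

/-- `s` is a (Carathéodory) trajectory of `H₃` on `[0, ∞)` with input `u`: the components are
locally absolutely continuous, start in the nonnegative orthant and satisfy the projected
equations at almost every time. -/
structure IsTrajectory (D : Data m d n) (u : ℝ → Port m d) (s : ℝ → State m n) : Prop where
  θ_ac : ∀ j i, ∀ T, 0 ≤ T → AbsolutelyContinuousOnInterval (fun t => (s t).θ j i) 0 T
  μ_ac : ∀ j i, ∀ T, 0 ≤ T → AbsolutelyContinuousOnInterval (fun t => (s t).μ j i) 0 T
  ξ_ac : ∀ j i, ∀ T, 0 ≤ T → AbsolutelyContinuousOnInterval (fun t => (s t).ξ j i) 0 T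
  θ_init : ∀ j i, 0 ≤ (s 0).θ j i
  μ_init : ∀ j i, 0 ≤ (s 0).μ j i
  ξ_init : ∀ j i, 0 ≤ (s 0).ξ j i
  θ_ode : ∀ j i, ∀ᵐ t ∂volume.restrict (Ici (0 : ℝ)),
    HasDerivAt (fun t => (s t).θ j i) (D.thetaDot (u t) (s t) j i) t
  μ_ode : ∀ j i, ∀ᵐ t ∂volume.restrict (Ici (0 : ℝ)),
    HasDerivAt (fun t => (s t).μ j i) (D.muDot (s t) j i) t
  ξ_ode : ∀ j i, ∀ᵐ t ∂volume.restrict (Ici (0 : ℝ)),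
    HasDerivAt (fun t => (s t).ξ j i) (D.xiDot (s t) j i) t

end Data

/-- Admissible inputs `t ↦ (w(t), b(t))` on `[0, ∞)`: locally absolutely continuous ones, so that
the port input `(ẇ, ḃ)` exists almost everywhere and is locally integrable. -/
structure IsAdmissibleInput (u : ℝ → Port m d) : Prop where
  weight_ac : ∀ j, ∀ T, 0 ≤ T → AbsolutelyContinuousOnInterval (fun t => (u t).weight j) 0 T
  bias_ac : ∀ j, ∀ T, 0 ≤ T → AbsolutelyContinuousOnInterval (fun t => (u t).bias j) 0 T

/-- The supply rate `ẏᵀ u̇`. -/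
def supplyRate (y u : ℝ → Port m d) (t : ℝ) : ℝ :=
  ∑ j, (inner ℝ (deriv (fun r => (y r).weight j) t) (deriv (fun r => (u r).weight j) t)
    + deriv (fun r => (y r).bias j) t * deriv (fun r => (u r).bias j) t)

/-- The dissipation inequality for the storage `V` and the supply rate `q` on `[a, b]`. -/
def IsDissipativeOn (V q : ℝ → ℝ) (a b : ℝ) : Prop :=
  IntervalIntegrable q volume a b ∧
    ∀ t₀ t₁, a ≤ t₀ → t₀ ≤ t₁ → t₁ ≤ b → V t₁ - V t₀ ≤ ∫ t in t₀..t₁, q t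

/-- `τ ≥ 0` is a switching instant of the signal `S` on `[0, ∞)`: `S` is not constant on any
neighbourhood of `τ` in `[0, ∞)`. -/
def IsSwitchingInstant {α : Type*} (S : ℝ → α) (τ : ℝ) : Prop :=
  0 ≤ τ ∧ ∃ᶠ t in 𝓝[Ici 0] τ, S t ≠ S τ

end DSVM

end

/-! An active constraint has zero velocity, so `V` is half the squared norm of the whole velocity
and splits into scalar terms `([p]⁺_x)² / 2` with `ẋ = [p]⁺_x` and `x ≥ 0`. Such a term jumps when
the projection switches, and switching instants may accumulate, so arguing interval by interval is
avoided. Instead, `posProj_dissipation` approximates the term by the absolutely continuous functions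
`(p² - min(p, 0)² exp(-k x)) / 2`, whose derivatives are at most `(p - min(p, 0) exp(-k x)) ṗ`, and
lets `k → ∞`. This gives the supply rate `ẋ ṗ` on every `[a, b]` with `0 ≤ a`, across all
switchings. With `p = h, ξ, g` for `θ, μ, ξ`, the cross terms cancel and the scalar rates sum to `ẏᵀ
u̇` (`supplyRate_eq_of_hasDerivAt`). The jump statements follow: `V` minus the supplied energy is
antitone, which gives left limits and downward jumps; lower semicontinuity of `V` then forces
right-continuity. -/

namespace AbsolutelyContinuousOnInterval

/-! ### Calculus of absolutely continuous functions. -/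

/-- Postcomposition with a Lipschitz function preserves absolute continuity. -/
theorem lipschitzOnWith_comp {X Y : Type*} [PseudoMetricSpace X] [PseudoMetricSpace Y]
    {f : ℝ → X} {g : X → Y} {a b : ℝ} {K : NNReal} {S : Set X}
    (hf : AbsolutelyContinuousOnInterval f a b) (hg : LipschitzOnWith K g S)
    (hS : MapsTo f (uIcc a b) S) :
    AbsolutelyContinuousOnInterval (fun t => g (f t)) a b := by
  rw [absolutelyContinuousOnInterval_iff] at hf ⊢
  intro ε hε
  obtain ⟨δ, hδ, h⟩ := hf (ε / (K + 1)) (by positivity)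
  refine ⟨δ, hδ, fun E hE hlen => ?_⟩
  calc ∑ i ∈ Finset.range E.1, dist (g (f (E.2 i).1)) (g (f (E.2 i).2))
      ≤ ∑ i ∈ Finset.range E.1, K * dist (f (E.2 i).1) (f (E.2 i).2) := by
        refine Finset.sum_le_sum fun i hi => ?_
        have := hE.1 i hi
        exact hg.dist_le_mul _ (hS this.1) _ (hS this.2)
    _ = K * ∑ i ∈ Finset.range E.1, dist (f (E.2 i).1) (f (E.2 i).2) := by
        rw [Finset.mul_sum]
    _ ≤ (K + 1) * ∑ i ∈ Finset.range E.1, dist (f (E.2 i).1) (f (E.2 i).2) := by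
        have : 0 ≤ ∑ i ∈ Finset.range E.1, dist (f (E.2 i).1) (f (E.2 i).2) :=
          Finset.sum_nonneg fun _ _ => dist_nonneg
        linarith
    _ < (K + 1) * (ε / (K + 1)) := by
        have := h E hE hlen
        gcongr
    _ = ε := by field_simp

/-- Postcomposition with a `C¹` function preserves absolute continuity. -/
theorem contDiff_comp {f g : ℝ → ℝ} {a b : ℝ}
    (hf : AbsolutelyContinuousOnInterval f a b) (hg : ContDiff ℝ 1 g) :
    AbsolutelyContinuousOnInterval (fun t => g (f t)) a b := by
  obtain ⟨c, hc⟩ := hf.exists_bound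
  obtain ⟨K, hK⟩ := (hg.contDiffOn (s := Icc (-c) c)).exists_lipschitzOnWith (by decide)
    (convex_Icc _ _) isCompact_Icc
  exact hf.lipschitzOnWith_comp hK fun t ht => abs_le.1 (hc t ht)

/-- An absolutely continuous function increases by at most the integral of an upper bound
for its derivative. -/
theorem sub_le_integral {f F : ℝ → ℝ} {a b : ℝ} (hab : a ≤ b)
    (hf : AbsolutelyContinuousOnInterval f a b) (hF : IntervalIntegrable F volume a b)
    (h : ∀ᵐ t, t ∈ Icc a b → ∃ f', HasDerivAt f f' t ∧ f' ≤ F t) :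
    f b - f a ≤ ∫ t in a..b, F t := by
  rw [← hf.integral_deriv_eq_sub]
  refine intervalIntegral.integral_mono_ae_restrict hab hf.intervalIntegrable_deriv hF ?_
  refine (ae_restrict_iff' measurableSet_Icc).2 ?_
  filter_upwards [h] with t ht hm
  obtain ⟨f', h1, h2⟩ := ht hm
  rwa [h1.deriv]

end AbsolutelyContinuousOnInterval

/-- Squaring removes the kink of the negative part at `0`, so the chain rule applies wherever the
inner function is differentiable. -/
theorem hasDerivAt_min_zero_sq (x : ℝ) :
    HasDerivAt (fun r : ℝ => min r 0 ^ 2) (2 * min x 0) x := by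
  rcases lt_trichotomy x 0 with hx | rfl | hx
  · rw [min_eq_left hx.le]
    have : HasDerivAt (fun r : ℝ => r ^ 2) (2 * x) x := by simpa using hasDerivAt_pow 2 x
    refine this.congr_of_eventuallyEq ?_
    filter_upwards [eventually_lt_nhds hx] with r hr
    rw [min_eq_left hr.le]
  · rw [hasDerivAt_iff_isLittleO]
    simp only [min_self, sub_zero, mul_zero, smul_zero, ne_eq, OfNat.ofNat_ne_zero,
      not_false_eq_true, zero_pow]
    have h1 : (fun r : ℝ => min r 0 ^ 2) =O[𝓝 0] fun r : ℝ => r ^ 2 := by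
      refine Asymptotics.IsBigO.of_bound 1 (Eventually.of_forall fun r => ?_)
      rcases le_total r 0 with h | h <;> simp [h]
    refine h1.trans_isLittleO ?_
    simpa using Asymptotics.isLittleO_pow_id (𝕜 := ℝ) one_lt_two
  · rw [min_eq_right hx.le, mul_zero]
    refine (hasDerivAt_const x (0 : ℝ)).congr_of_eventuallyEq ?_
    filter_upwards [eventually_gt_nhds hx] with r hr
    simp [hr.le]

theorem AbsolutelyContinuousOnInterval.min_zero_sq {f : ℝ → ℝ} {a b : ℝ}
    (hf : AbsolutelyContinuousOnInterval f a b) :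
    AbsolutelyContinuousOnInterval (fun t => min (f t) 0 ^ 2) a b := by
  have h : AbsolutelyContinuousOnInterval (fun t => min (f t) 0) a b :=
    hf.lipschitzOnWith_comp ((LipschitzWith.id.min_const 0).lipschitzOnWith (s := univ))
      (mapsTo_univ _ _)
  simpa [pow_two] using! h.mul h

/-! ### The scalar projected equation. -/

namespace DSVM

/-- The projection keeps trajectories in the nonnegative half-line. -/
theorem nonneg_of_hasDerivAt_posProj {x p : ℝ → ℝ} {T : ℝ} (hT : 0 ≤ T)
    (hx : AbsolutelyContinuousOnInterval x 0 T) (hx0 : 0 ≤ x 0)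
    (hode : ∀ᵐ t, t ∈ Icc 0 T → HasDerivAt x (posProj (p t) (x t)) t) : 0 ≤ x T := by
  -- The squared negative part of `x` cannot grow: below zero the projection passes only positive
  -- velocities.
  have h := hx.min_zero_sq.sub_le_integral (F := fun _ => 0) hT (by simp) (by
    filter_upwards [hode] with t ht hm
    refine ⟨_, (hasDerivAt_min_zero_sq (x t)).comp t (ht hm), ?_⟩
    unfold posProj
    split_ifs with hc
    · rcases le_or_gt 0 (x t) with h0 | h0
      · simp [h0]
      · have hp : 0 < p t := hc.resolve_left (not_lt.2 h0.le)
        rw [min_eq_left h0.le]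
        nlinarith
    · simp)
  simp only [intervalIntegral.integral_zero, min_eq_right hx0] at h
  have h2 : min (x T) 0 = 0 := by nlinarith [sq_nonneg (min (x T) 0)]
  exact min_eq_right_iff.1 h2

/-- All the discontinuity is put into the indicator of `z = 0`, which is the limit of `exp(-k z)`
for `z ≥ 0`. -/
theorem posProj_eq_of_nonneg {p z : ℝ} (hz : 0 ≤ z) :
    posProj p z = p - min p 0 * (if z = 0 then 1 else 0) := by
  unfold posProj
  rcases hz.eq_or_lt with rfl | hz
  · rcases le_or_gt p 0 with h | h
    · simp [h, not_lt.2 h]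
    · simp [h, h.le]
  · simp [hz, hz.ne']

theorem posProj_sq_eq_of_nonneg {p z : ℝ} (hz : 0 ≤ z) :
    posProj p z ^ 2 = p ^ 2 - min p 0 ^ 2 * (if z = 0 then 1 else 0) := by
  unfold posProj
  rcases hz.eq_or_lt with rfl | hz
  · rcases le_or_gt p 0 with h | h
    · simp [h, not_lt.2 h]
    · simp [h, h.le]
  · simp [hz, hz.ne']

/-- This sign lets the term produced by differentiating `exp(-k x)` be dropped for every `k`,
however large the factor `k` is. -/
theorem min_zero_sq_mul_posProj_nonpos (p z : ℝ) : min p 0 ^ 2 * posProj p z ≤ 0 := by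
  unfold posProj
  split_ifs
  · rcases le_total p 0 with h | h
    · exact mul_nonpos_of_nonneg_of_nonpos (sq_nonneg _) h
    · simp [h]
  · simp

theorem tendsto_exp_neg_nat_mul {z : ℝ} (hz : 0 ≤ z) :
    Tendsto (fun k : ℕ => Real.exp (-(k * z))) atTop (𝓝 (if z = 0 then 1 else 0)) := by
  rcases hz.eq_or_lt with rfl | hz
  · simp
  · rw [if_neg hz.ne']
    exact Real.tendsto_exp_neg_atTop_nhds_zero.comp
      (tendsto_natCast_atTop_atTop.atTop_mul_const hz)

/-- Scalar Krasovskii estimate: along `ẋ = [p]⁺_x` the storage `ẋ² / 2` satisfies the dissipation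
inequality with supply rate `ẋ ṗ`. It is the limit of the estimates for the absolutely continuous
functions `(p² - min(p, 0)² exp(-k x)) / 2`. -/
theorem posProj_dissipation {x p : ℝ → ℝ} {a b : ℝ} (hab : a ≤ b)
    (hx : AbsolutelyContinuousOnInterval x a b) (hp : AbsolutelyContinuousOnInterval p a b)
    (hx0 : ∀ t ∈ Icc a b, 0 ≤ x t)
    (hode : ∀ᵐ t, t ∈ Icc a b → HasDerivAt x (posProj (p t) (x t)) t) :
    IntervalIntegrable (fun t => posProj (p t) (x t) * deriv p t) volume a b ∧
      1 / 2 * posProj (p b) (x b) ^ 2 - 1 / 2 * posProj (p a) (x a) ^ 2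
        ≤ ∫ t in a..b, posProj (p t) (x t) * deriv p t := by
  have hpd := hp.intervalIntegrable_deriv
  have hmem : ∀ t ∈ uIoc a b, t ∈ Icc a b := fun t ht => by
    rw [uIoc_of_le hab] at ht; exact Ioc_subset_Icc_self ht
  let E : ℕ → ℝ → ℝ := fun k t => Real.exp (-(k * x t))
  have hEac : ∀ k, AbsolutelyContinuousOnInterval (E k) a b := fun k =>
    hx.contDiff_comp (g := fun r => Real.exp (-(k * r))) (by fun_prop)
  have hmac : AbsolutelyContinuousOnInterval (fun t => min (p t) 0) a b :=
    hp.lipschitzOnWith_comp ((LipschitzWith.id.min_const 0).lipschitzOnWith (s := univ))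
      (mapsTo_univ _ _)
  have hFint : ∀ k, IntervalIntegrable (fun t => (p t - min (p t) 0 * E k t) * deriv p t)
      volume a b := fun k =>
    hpd.continuousOn_mul (hp.fun_sub (hmac.mul (hEac k))).continuousOn
  have hlim : ∀ t ∈ Icc a b, Tendsto (fun k => (p t - min (p t) 0 * E k t) * deriv p t) atTop
      (𝓝 (posProj (p t) (x t) * deriv p t)) := fun t ht => by
    rw [posProj_eq_of_nonneg (hx0 t ht)]
    exact (tendsto_const_nhds.sub
      ((tendsto_exp_neg_nat_mul (hx0 t ht)).const_mul _)).mul_const _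
  -- Since `0 ≤ E k t ≤ 1`, the factor `p - min(p, 0) E` lies between `0` and `p`; this gives a
  -- majorant independent of `k`.
  have hbound : ∀ k, ∀ t ∈ Icc a b,
      ‖(p t - min (p t) 0 * E k t) * deriv p t‖ ≤ ‖p t * deriv p t‖ := fun k t ht => by
    rw [norm_mul, norm_mul]
    refine mul_le_mul_of_nonneg_right ?_ (norm_nonneg _)
    have h0 : 0 ≤ E k t := (Real.exp_pos _).le
    have h1 : E k t ≤ 1 := Real.exp_le_one_iff.2 (by have := hx0 t ht; simp; positivity)
    rcases le_total (p t) 0 with h | h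
    · rw [min_eq_left h, show p t - p t * E k t = p t * (1 - E k t) by ring, norm_mul]
      refine mul_le_of_le_one_right (norm_nonneg _) ?_
      rw [Real.norm_eq_abs, abs_le]
      constructor <;> linarith
    · simp [h]
  have hbi : IntervalIntegrable (fun t => p t * deriv p t) volume a b :=
    hpd.continuousOn_mul hp.continuousOn
  have hmeas : AEStronglyMeasurable (fun t => posProj (p t) (x t) * deriv p t)
      (volume.restrict (uIoc a b)) := by
    refine aestronglyMeasurable_of_tendsto_ae atTop (fun k => (hFint k).def'.aestronglyMeasurable)
      ((ae_restrict_iff' measurableSet_uIoc).2 (Eventually.of_forall fun t ht => ?_))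
    exact hlim t (hmem t ht)
  refine ⟨?_, ?_⟩
  · refine hbi.mono_fun hmeas ((ae_restrict_iff' measurableSet_uIoc).2
      (Eventually.of_forall fun t ht => ?_))
    exact le_of_tendsto (hlim t (hmem t ht)).norm
      (Eventually.of_forall fun k => hbound k t (hmem t ht))
  · have hint := intervalIntegral.tendsto_integral_filter_of_dominated_convergence (μ := volume)
      (a := a) (b := b) (fun t => ‖p t * deriv p t‖)
      (Eventually.of_forall fun k => (hFint k).def'.aestronglyMeasurable)
      (Eventually.of_forall fun k => Eventually.of_forall fun t ht => hbound k t (hmem t ht))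
      hbi.norm (Eventually.of_forall fun t ht => hlim t (hmem t ht))
    have hval : ∀ t ∈ Icc a b, Tendsto (fun k => 1 / 2 * (p t ^ 2 - min (p t) 0 ^ 2 * E k t)) atTop
        (𝓝 (1 / 2 * posProj (p t) (x t) ^ 2)) := fun t ht => by
      rw [posProj_sq_eq_of_nonneg (hx0 t ht)]
      exact (tendsto_const_nhds.sub
        ((tendsto_exp_neg_nat_mul (hx0 t ht)).const_mul _)).const_mul _
    refine le_of_tendsto_of_tendsto' ((hval b ⟨hab, le_rfl⟩).sub (hval a ⟨le_rfl, hab⟩)) hint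
      fun k => ?_
    have hac : AbsolutelyContinuousOnInterval
        (fun t => 1 / 2 * (p t ^ 2 - min (p t) 0 ^ 2 * E k t)) a b := by
      refine AbsolutelyContinuousOnInterval.const_mul _
        (AbsolutelyContinuousOnInterval.fun_sub ?_ (hp.min_zero_sq.mul (hEac k)))
      simpa [pow_two] using! hp.mul hp
    refine hac.sub_le_integral hab (hFint k) ?_
    filter_upwards [hode, hp.ae_differentiableAt] with t h1 h2 hm
    have h2 := (h2 (by rwa [uIcc_of_le hab])).hasDerivAt
    have h1 := h1 hm
    have hE : HasDerivAt (E k) (Real.exp (-(k * x t)) * -(k * posProj (p t) (x t))) t :=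
      ((h1.const_mul (k : ℝ)).neg).exp
    have hM := (hasDerivAt_min_zero_sq (p t)).comp t h2
    refine ⟨_, ((h2.pow 2).sub (hM.mul hE)).const_mul (1 / 2), ?_⟩
    -- The derivative exceeds the desired integrand by `(k / 2) E min(p, 0)² ẋ`, which is
    -- nonpositive.
    have h3 := min_zero_sq_mul_posProj_nonpos (p t) (x t)
    have h4 : 0 ≤ (k : ℝ) * E k t := mul_nonneg k.cast_nonneg (Real.exp_pos _).le
    have h5 := mul_nonneg h4 (neg_nonneg.2 h3)
    simp only [E, Function.comp_apply] at h5 ⊢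
    push_cast
    nlinarith

/-- Being unprojected is an open condition, so there the function agrees locally with `p²`; at a
projected point its value is `0`, the least possible for a square. -/
theorem lowerSemicontinuousWithinAt_posProj_sq {x p : ℝ → ℝ} {S : Set ℝ} {τ : ℝ}
    (hx : ContinuousWithinAt x S τ) (hp : ContinuousWithinAt p S τ) :
    LowerSemicontinuousWithinAt (fun t => posProj (p t) (x t) ^ 2) S τ := by
  by_cases h : 0 < x τ ∨ 0 < p τ
  · have hev : ∀ᶠ t in 𝓝[S] τ, 0 < x t ∨ 0 < p t := by
      rcases h with h | h
      · filter_upwards [hx.eventually (eventually_gt_nhds h)] with t ht using Or.inl ht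
      · filter_upwards [hp.eventually (eventually_gt_nhds h)] with t ht using Or.inr ht
    intro c hc
    simp only [posProj, if_pos h] at hc
    filter_upwards [hev, (hp.pow 2).eventually (eventually_gt_nhds hc)] with t h1 h2
    simpa [posProj, if_pos h1] using h2
  · intro c hc
    simp only [posProj, if_neg h] at hc
    refine Eventually.of_forall fun t => lt_of_lt_of_le hc ?_
    simpa using sq_nonneg _

end DSVM

theorem IntervalIntegrable.fun_finsetSum {ι : Type*} (S : Finset ι) {f : ι → ℝ → ℝ} {a b : ℝ}
    (h : ∀ i ∈ S, IntervalIntegrable (f i) volume a b) :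
    IntervalIntegrable (fun t => ∑ i ∈ S, f i t) volume a b := by
  simpa only [Finset.sum_fn] using IntervalIntegrable.sum S h

/-! ### One-sided limits of a storage function. -/

namespace DSVM

theorem isDissipativeOn_of_forall_le {V q : ℝ → ℝ} {a b : ℝ} (ha : 0 ≤ a) (hab : a ≤ b)
    (h : ∀ t₀ t₁, 0 ≤ t₀ → t₀ ≤ t₁ →
      IntervalIntegrable q volume t₀ t₁ ∧ V t₁ - V t₀ ≤ ∫ t in t₀..t₁, q t) :
    IsDissipativeOn V q a b :=
  ⟨(h a b ha hab).1, fun t₀ t₁ h0 h1 _ => (h t₀ t₁ (ha.trans h0) h1).2⟩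

theorem continuousOn_integral_of_intervalIntegrable {q : ℝ → ℝ} {T : ℝ} (hT : 0 ≤ T)
    (hq : IntervalIntegrable q volume 0 T) :
    ContinuousOn (fun t => ∫ r in 0..t, q r) (Icc 0 T) := by
  have := (hq.absolutelyContinuousOnInterval_intervalIntegral (c := 0) (by simp)).continuousOn
  rwa [uIcc_of_le hT] at this

/-- A storage function satisfying a dissipation inequality has left limits, and jumps down only. -/
theorem exists_tendsto_left_of_dissipative {V q : ℝ → ℝ} {τ : ℝ} (hτ : 0 < τ)
    (h : IsDissipativeOn V q 0 τ) :
    ∃ v, Tendsto V (𝓝[<] τ) (𝓝 v) ∧ V τ ≤ v := by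
  obtain ⟨hq, hV⟩ := h
  let I : ℝ → ℝ := fun t => ∫ r in 0..t, q r
  have hsub : ∀ t ∈ Icc 0 τ, IntervalIntegrable q volume 0 t := fun t ht =>
    hq.mono_set (by rw [uIcc_of_le ht.1, uIcc_of_le hτ.le]; exact Icc_subset_Icc_right ht.2)
  -- Subtracting the supplied energy turns dissipation into monotonicity; `I` is continuous, so `V`
  -- inherits the left limit.
  have hanti : AntitoneOn (fun t => V t - I t) (Icc 0 τ) := fun t ht r hr htr => by
    have h1 := hV t r ht.1 htr hr.2
    rw [← intervalIntegral.integral_interval_sub_left (hsub r hr) (hsub t ht)] at h1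
    simp only [I]
    linarith
  have hlb : ∀ t ∈ Ioo 0 τ, V τ - I τ ≤ V t - I t := fun t ht =>
    hanti ⟨ht.1.le, ht.2.le⟩ ⟨hτ.le, le_rfl⟩ ht.2.le
  have hlim := AntitoneOn.tendsto_nhdsWithin_Ioo_left (nonempty_Ioo.2 hτ)
    (hanti.mono Ioo_subset_Icc_self)
    ⟨V τ - I τ, by rintro _ ⟨t, ht, rfl⟩; exact hlb t ht⟩
  have hI : Tendsto I (𝓝[<] τ) (𝓝 (I τ)) := by
    have := continuousOn_integral_of_intervalIntegrable hτ.le hq τ ⟨hτ.le, le_rfl⟩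
    exact this.tendsto.mono_left (nhdsWithin_le_iff.2 (mem_of_superset (Ioo_mem_nhdsLT hτ)
      Ioo_subset_Icc_self))
  have hsum := hlim.add hI
  simp only [sub_add_cancel] at hsum
  refine ⟨_, hsum, ?_⟩
  have : V τ - I τ ≤ sInf ((fun t => V t - I t) '' Ioo 0 τ) :=
    le_csInf ((nonempty_Ioo.2 hτ).image _) (by rintro _ ⟨t, ht, rfl⟩; exact hlb t ht)
  linarith

/-- A lower semicontinuous storage function satisfying a dissipation inequality is
right-continuous. -/
theorem tendsto_right_of_dissipative {V q : ℝ → ℝ} {τ T : ℝ} (hτ : 0 ≤ τ) (hT : τ < T)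
    (h : IsDissipativeOn V q 0 T) (hlsc : LowerSemicontinuousWithinAt V (Ici 0) τ) :
    Tendsto V (𝓝[>] τ) (𝓝 (V τ)) := by
  obtain ⟨hq, hV⟩ := h
  have hIoo : Ioo τ T ∈ 𝓝[>] τ := Ioo_mem_nhdsGT hT
  have hI : Tendsto (fun t => V τ + ∫ r in τ..t, q r) (𝓝[>] τ) (𝓝 (V τ)) := by
    have hqτ : IntervalIntegrable q volume τ T := hq.mono_set (by
      rw [uIcc_of_le hT.le, uIcc_of_le (hτ.trans hT.le)]; exact Icc_subset_Icc_left hτ)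
    have hc := (hqτ.absolutelyContinuousOnInterval_intervalIntegral (c := τ) (by simp)).continuousOn
    rw [uIcc_of_le hT.le] at hc
    have h1 := (hc τ ⟨le_rfl, hT.le⟩).tendsto.mono_left
      (nhdsWithin_le_iff.2 (mem_of_superset hIoo Ioo_subset_Icc_self))
    simpa using h1.const_add (V τ)
  -- Lower semicontinuity bounds `V` from below near `τ`; the dissipation inequality started at `τ`
  -- bounds it from above.
  refine tendsto_order.2 ⟨fun c hc => ?_, fun c hc => ?_⟩
  · exact (hlsc c hc).filter_mono (nhdsWithin_mono _ fun t ht => hτ.trans (le_of_lt ht))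
  · filter_upwards [hI.eventually (eventually_lt_nhds hc), hIoo] with t h1 h2
    have := hV τ t hτ h2.1.le h2.2.le
    linarith

/-! ### Assembling the scalar estimates for `H₃`. -/

namespace Data

variable {m d : ℕ} {n : Fin m → ℕ}

theorem sum_compl_posProj_sq {ι : Type*} [Fintype ι] [DecidableEq ι] (S : Finset ι) (p z : ι → ℝ)
    (hS : ∀ i ∈ S, z i = 0 ∧ p i ≤ 0) :
    ∑ i ∈ Sᶜ, posProj (p i) (z i) ^ 2 = ∑ i, posProj (p i) (z i) ^ 2 := by
  refine Finset.sum_subset (Finset.subset_univ _) fun i _ hi => ?_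
  obtain ⟨h1, h2⟩ := hS i (by simpa using hi)
  simp [posProj, h1, not_lt.2 h2]

/-- Active constraints have zero velocity, so the storage is half the squared norm of the
velocity of the state. -/
theorem storage_eq (D : Data m d n) (u : Port m d) (s : State m n) :
    D.storage u s = ∑ j, (∑ i, 1 / 2 * D.thetaDot u s j i ^ 2
      + ∑ i, 1 / 2 * D.muDot s j i ^ 2 + ∑ i, 1 / 2 * D.xiDot s j i ^ 2) := by
  unfold storage
  rw [Finset.mul_sum]
  refine Finset.sum_congr rfl fun j _ => ?_
  simp only [← Finset.mul_sum, ← mul_add]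
  have e1 := sum_compl_posProj_sq (D.sigma u s j) (D.h u s j) (s.θ j) (by simp [sigma])
  have e2 := sum_compl_posProj_sq (D.iota s j) (s.ξ j) (s.μ j) (by simp [iota])
  have e3 := sum_compl_posProj_sq (D.rho s j) (D.g s j) (s.ξ j) (by simp [rho])
  simp only [thetaDot, muDot, xiDot]
  rw [e1, e2, e3]

theorem storage_nonneg (D : Data m d n) (u : Port m d) (s : State m n) : 0 ≤ D.storage u s := by
  rw [storage_eq]
  positivity

variable {D : Data m d n} {u : ℝ → Port m d} {s : ℝ → State m n}

theorem h_ac (hu : IsAdmissibleInput u) (hs : D.IsTrajectory u s) (j : Fin m) (i : Fin (n j))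
    {T : ℝ} (hT : 0 ≤ T) :
    AbsolutelyContinuousOnInterval (fun t => D.h (u t) (s t) j i) 0 T := by
  have hin : AbsolutelyContinuousOnInterval
      (fun t => inner ℝ ((u t).weight j) (D.x j i)) 0 T := by
    have := (hu.weight_ac j T hT).lipschitzOnWith_comp
      ((innerSL ℝ (D.x j i)).lipschitz.lipschitzOnWith (s := univ)) (mapsTo_univ _ _)
    simpa [real_inner_comm] using this
  exact ((LipschitzWith.const (1 : ℝ)).lipschitzOnWith.absolutelyContinuousOnInterval.fun_sub
    (hs.ξ_ac j i T hT)).fun_sub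
      ((hin.fun_add (hu.bias_ac j T hT)).const_mul (D.y j i))

theorem g_ac (hs : D.IsTrajectory u s) (j : Fin m) (i : Fin (n j)) {T : ℝ} (hT : 0 ≤ T) :
    AbsolutelyContinuousOnInterval (fun t => D.g (s t) j i) 0 T :=
  ((LipschitzWith.const (-((m : ℝ) * D.C))).lipschitzOnWith.absolutelyContinuousOnInterval.fun_sub
    (hs.μ_ac j i T hT)).fun_add (hs.θ_ac j i T hT)

theorem ae_mem_Icc_of_restrict_Ici {P : ℝ → Prop} (h : ∀ᵐ t ∂volume.restrict (Ici (0 : ℝ)), P t)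
    {a b : ℝ} (ha : 0 ≤ a) : ∀ᵐ t, t ∈ Icc a b → P t := by
  filter_upwards [(ae_restrict_iff' measurableSet_Ici).1 h] with t ht hm
  exact ht (ha.trans hm.1)

theorem IsTrajectory.θ_nonneg (hs : D.IsTrajectory u s) (j : Fin m) (i : Fin (n j)) {t : ℝ}
    (ht : 0 ≤ t) : 0 ≤ (s t).θ j i :=
  nonneg_of_hasDerivAt_posProj (x := fun t => (s t).θ j i) ht (hs.θ_ac j i t ht) (hs.θ_init j i)
    (ae_mem_Icc_of_restrict_Ici (hs.θ_ode j i) le_rfl)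

theorem IsTrajectory.μ_nonneg (hs : D.IsTrajectory u s) (j : Fin m) (i : Fin (n j)) {t : ℝ}
    (ht : 0 ≤ t) : 0 ≤ (s t).μ j i :=
  nonneg_of_hasDerivAt_posProj (x := fun t => (s t).μ j i) ht (hs.μ_ac j i t ht) (hs.μ_init j i)
    (ae_mem_Icc_of_restrict_Ici (hs.μ_ode j i) le_rfl)

theorem IsTrajectory.ξ_nonneg (hs : D.IsTrajectory u s) (j : Fin m) (i : Fin (n j)) {t : ℝ}
    (ht : 0 ≤ t) : 0 ≤ (s t).ξ j i :=
  nonneg_of_hasDerivAt_posProj (x := fun t => (s t).ξ j i) ht (hs.ξ_ac j i t ht) (hs.ξ_init j i)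
    (ae_mem_Icc_of_restrict_Ici (hs.ξ_ode j i) le_rfl)

/-- Pointwise power balance: the interconnection terms between `θ`, `μ` and `ξ` cancel. -/
theorem supplyRate_eq_of_hasDerivAt {t : ℝ}
    (hw : ∀ j, DifferentiableAt ℝ (fun r => (u r).weight j) t)
    (hb : ∀ j, DifferentiableAt ℝ (fun r => (u r).bias j) t)
    (hθ : ∀ j i, HasDerivAt (fun r => (s r).θ j i) (D.thetaDot (u t) (s t) j i) t)
    (hμ : ∀ j i, HasDerivAt (fun r => (s r).μ j i) (D.muDot (s t) j i) t)
    (hξ : ∀ j i, HasDerivAt (fun r => (s r).ξ j i) (D.xiDot (s t) j i) t) :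
    supplyRate (fun r => D.output (s r)) u t =
      ∑ j, (∑ i, D.thetaDot (u t) (s t) j i * deriv (fun r => D.h (u r) (s r) j i) t
        + ∑ i, D.muDot (s t) j i * deriv (fun r => (s r).ξ j i) t
        + ∑ i, D.xiDot (s t) j i * deriv (fun r => D.g (s r) j i) t) := by
  unfold supplyRate
  refine Finset.sum_congr rfl fun j _ => ?_
  have hζ : HasDerivAt (fun r => (D.output (s r)).weight j)
      (∑ i, D.thetaDot (u t) (s t) j i • (-(D.y j i • D.x j i))) t :=
    HasDerivAt.fun_sum (u := Finset.univ) fun i _ =>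
      (hθ j i).smul_const (-(D.y j i • D.x j i))
  have hη : HasDerivAt (fun r => (D.output (s r)).bias j)
      (∑ i, D.thetaDot (u t) (s t) j i * (-D.y j i)) t :=
    HasDerivAt.fun_sum (u := Finset.univ) fun i _ => (hθ j i).mul_const (-D.y j i)
  rw [hζ.deriv, hη.deriv, sum_inner, Finset.sum_mul, ← Finset.sum_add_distrib,
    ← Finset.sum_add_distrib, ← Finset.sum_add_distrib]
  refine Finset.sum_congr rfl fun i _ => ?_
  have hh : HasDerivAt (fun r => D.h (u r) (s r) j i)
      (0 - D.xiDot (s t) j i - D.y j i * (inner ℝ (deriv (fun r => (u r).weight j) t) (D.x j i)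
        + deriv (fun r => (u r).bias j) t)) t := by
    have h1 := (hw j).hasDerivAt.inner ℝ (hasDerivAt_const t (D.x j i))
    simp only [inner_zero_right, zero_add] at h1
    exact ((hasDerivAt_const t (1 : ℝ)).sub (hξ j i)).sub
      ((h1.add (hb j).hasDerivAt).const_mul (D.y j i))
  have hg : HasDerivAt (fun r => D.g (s r) j i)
      (0 - D.muDot (s t) j i + D.thetaDot (u t) (s t) j i) t :=
    ((hasDerivAt_const t (-((m : ℝ) * D.C))).sub (hμ j i)).add (hθ j i)
  -- The term `-θ̇ ξ̇` from `ḣ` cancels `ξ̇ θ̇` from `ġ`, and `μ̇ ξ̇` cancels `-ξ̇ μ̇`; only the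
  -- terms in `ẇ` and `ḃ` remain.
  rw [hh.deriv, hg.deriv, (hξ j i).deriv, inner_smul_left, inner_neg_left, inner_smul_left,
    real_inner_comm]
  simp only [conj_trivial]
  ring

/-- The dissipation inequality for `H₃` on an arbitrary interval. -/
theorem IsTrajectory.storage_sub_le (hu : IsAdmissibleInput u) (hs : D.IsTrajectory u s)
    {a b : ℝ} (ha : 0 ≤ a) (hab : a ≤ b) :
    IntervalIntegrable (supplyRate (fun t => D.output (s t)) u) volume a b ∧
      D.storage (u b) (s b) - D.storage (u a) (s a)
        ≤ ∫ t in a..b, supplyRate (fun t => D.output (s t)) u t := by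
  have hb : 0 ≤ b := ha.trans hab
  have hsub : uIcc a b ⊆ uIcc 0 b := by
    rw [uIcc_of_le hab, uIcc_of_le hb]; exact Icc_subset_Icc_left ha
  have Hθ := fun j i => posProj_dissipation hab ((hs.θ_ac j i b hb).mono hsub)
    ((h_ac hu hs j i hb).mono hsub) (fun t ht => hs.θ_nonneg j i (ha.trans ht.1))
    (ae_mem_Icc_of_restrict_Ici (hs.θ_ode j i) ha)
  have Hμ := fun j i => posProj_dissipation hab ((hs.μ_ac j i b hb).mono hsub)
    ((hs.ξ_ac j i b hb).mono hsub) (fun t ht => hs.μ_nonneg j i (ha.trans ht.1))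
    (ae_mem_Icc_of_restrict_Ici (hs.μ_ode j i) ha)
  have Hξ := fun j i => posProj_dissipation hab ((hs.ξ_ac j i b hb).mono hsub)
    ((g_ac hs j i hb).mono hsub) (fun t ht => hs.ξ_nonneg j i (ha.trans ht.1))
    (ae_mem_Icc_of_restrict_Ici (hs.ξ_ode j i) ha)
  let Q : ℝ → ℝ := fun t =>
    ∑ j, (∑ i, D.thetaDot (u t) (s t) j i * deriv (fun r => D.h (u r) (s r) j i) t
      + ∑ i, D.muDot (s t) j i * deriv (fun r => (s r).ξ j i) t
      + ∑ i, D.xiDot (s t) j i * deriv (fun r => D.g (s r) j i) t)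
  have iθ : ∀ j, IntervalIntegrable (fun t => ∑ i, D.thetaDot (u t) (s t) j i *
      deriv (fun r => D.h (u r) (s r) j i) t) volume a b := fun j =>
    IntervalIntegrable.fun_finsetSum _ fun i _ => (Hθ j i).1
  have iμ : ∀ j, IntervalIntegrable (fun t => ∑ i, D.muDot (s t) j i *
      deriv (fun r => (s r).ξ j i) t) volume a b := fun j =>
    IntervalIntegrable.fun_finsetSum _ fun i _ => (Hμ j i).1
  have iξ : ∀ j, IntervalIntegrable (fun t => ∑ i, D.xiDot (s t) j i *
      deriv (fun r => D.g (s r) j i) t) volume a b := fun j =>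
    IntervalIntegrable.fun_finsetSum _ fun i _ => (Hξ j i).1
  have hQ : IntervalIntegrable Q volume a b :=
    IntervalIntegrable.fun_finsetSum _ fun j _ => ((iθ j).add (iμ j)).add (iξ j)
  have hae : ∀ᵐ t, t ∈ uIoc a b → supplyRate (fun t => D.output (s t)) u t = Q t := by
    have hw := ae_all_iff.2 fun j =>
      -- The weights are vector-valued, so their almost everywhere differentiability is drawn from
      -- bounded variation.
      (hu.weight_ac j b hb).boundedVariationOn.ae_differentiableAt_of_mem_uIcc
    have hbd := ae_all_iff.2 fun j => (hu.bias_ac j b hb).ae_differentiableAt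
    have hθ := ae_all_iff.2 fun j => ae_all_iff.2 fun i =>
      ae_mem_Icc_of_restrict_Ici (hs.θ_ode j i) (b := b) ha
    have hμ := ae_all_iff.2 fun j => ae_all_iff.2 fun i =>
      ae_mem_Icc_of_restrict_Ici (hs.μ_ode j i) (b := b) ha
    have hξ := ae_all_iff.2 fun j => ae_all_iff.2 fun i =>
      ae_mem_Icc_of_restrict_Ici (hs.ξ_ode j i) (b := b) ha
    filter_upwards [hw, hbd, hθ, hμ, hξ] with t h1 h2 h3 h4 h5 hm
    have hm' := uIoc_subset_uIcc hm
    have hm2 := hm'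
    rw [uIcc_of_le hab] at hm2
    exact supplyRate_eq_of_hasDerivAt (fun j => h1 j (hsub hm')) (fun j => h2 j (hsub hm'))
      (fun j i => h3 j i hm2) (fun j i => h4 j i hm2) (fun j i => h5 j i hm2)
  refine ⟨hQ.congr_ae ((ae_restrict_iff' measurableSet_uIoc).2 ?_), ?_⟩
  · filter_upwards [hae] with t ht hm using (ht hm).symm
  rw [intervalIntegral.integral_congr_ae hae, intervalIntegral.integral_finsetSum
    fun j _ => ((iθ j).add (iμ j)).add (iξ j), storage_eq, storage_eq, ← Finset.sum_sub_distrib]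
  refine Finset.sum_le_sum fun j _ => ?_
  simp only [thetaDot, muDot, xiDot] at iθ iμ iξ ⊢
  rw [intervalIntegral.integral_add ((iθ j).add (iμ j)) (iξ j),
    intervalIntegral.integral_add (iθ j) (iμ j),
    intervalIntegral.integral_finsetSum fun i _ => (Hθ j i).1,
    intervalIntegral.integral_finsetSum fun i _ => (Hμ j i).1,
    intervalIntegral.integral_finsetSum fun i _ => (Hξ j i).1]
  have e1 := Finset.sum_le_sum fun i (_ : i ∈ Finset.univ) => (Hθ j i).2
  have e2 := Finset.sum_le_sum fun i (_ : i ∈ Finset.univ) => (Hμ j i).2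
  have e3 := Finset.sum_le_sum fun i (_ : i ∈ Finset.univ) => (Hξ j i).2
  rw [Finset.sum_sub_distrib] at e1 e2 e3
  linarith

theorem continuousWithinAt_Ici_of_ac {f : ℝ → ℝ} {τ : ℝ} (hτ : 0 ≤ τ)
    (hf : ∀ T, 0 ≤ T → AbsolutelyContinuousOnInterval f 0 T) :
    ContinuousWithinAt f (Ici 0) τ := by
  -- Ending the interval beyond `τ` makes it a neighbourhood of `τ` within `[0, ∞)`, also when `τ =
  -- 0`.
  have h1 := (hf (τ + 1) (by linarith)).continuousOn
  rw [uIcc_of_le (by linarith)] at h1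
  refine (h1 τ ⟨hτ, by linarith⟩).mono_of_mem_nhdsWithin ?_
  filter_upwards [self_mem_nhdsWithin,
    mem_nhdsWithin_of_mem_nhds (Iio_mem_nhds (lt_add_one τ))] with t h2 h3 using ⟨h2, le_of_lt h3⟩

theorem IsTrajectory.lowerSemicontinuousWithinAt_storage (hu : IsAdmissibleInput u)
    (hs : D.IsTrajectory u s) {τ : ℝ} (hτ : 0 ≤ τ) :
    LowerSemicontinuousWithinAt (fun t => D.storage (u t) (s t)) (Ici 0) τ := by
  have half : ∀ {f : ℝ → ℝ}, LowerSemicontinuousWithinAt f (Ici 0) τ →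
      LowerSemicontinuousWithinAt (fun t => 1 / 2 * f t) (Ici 0) τ := fun hf c hc => by
    filter_upwards [hf (2 * c) (by linarith)] with t ht
    linarith
  have hθ := fun j i => continuousWithinAt_Ici_of_ac hτ (hs.θ_ac j i)
  have hμ := fun j i => continuousWithinAt_Ici_of_ac hτ (hs.μ_ac j i)
  have hξ := fun j i => continuousWithinAt_Ici_of_ac hτ (hs.ξ_ac j i)
  have hh := fun j i => continuousWithinAt_Ici_of_ac hτ fun _ hT => h_ac hu hs j i hT
  have hg := fun j i => continuousWithinAt_Ici_of_ac hτ fun _ hT => g_ac hs j i hT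
  simp only [storage_eq]
  refine lowerSemicontinuousWithinAt_sum fun j _ => LowerSemicontinuousWithinAt.add
    (LowerSemicontinuousWithinAt.add ?_ ?_) ?_
  · exact lowerSemicontinuousWithinAt_sum fun i _ =>
      half (lowerSemicontinuousWithinAt_posProj_sq (hθ j i) (hh j i))
  · exact lowerSemicontinuousWithinAt_sum fun i _ =>
      half (lowerSemicontinuousWithinAt_posProj_sq (hμ j i) (hξ j i))
  · exact lowerSemicontinuousWithinAt_sum fun i _ =>
      half (lowerSemicontinuousWithinAt_posProj_sq (hξ j i) (hg j i))

end Data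

end DSVM

/-- Passivity of `H₃` from `u̇ = (ẇ, ḃ)` to `ẏ = (ζ̇, η̇)` along every trajectory: the Krasovskii
storage is nonnegative, satisfies the dissipation inequality between each pair of switching
instants of `σ`, of `ι` and of `ρ` (and on every `[0, T]`), and never jumps upwards. -/
theorem mainTheorem3 {m d : ℕ} {n : Fin m → ℕ} (D : DSVM.Data m d n)
    (u : ℝ → DSVM.Port m d) (hu : DSVM.IsAdmissibleInput u)
    (s : ℝ → DSVM.State m n) (hs : D.IsTrajectory u s)
    (V : ℝ → ℝ) (hV : V = fun t => D.storage (u t) (s t))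
    (q : ℝ → ℝ) (hq : q = DSVM.supplyRate (fun t => D.output (s t)) u) :
    (∀ t, 0 ≤ V t) ∧
    (∀ τ₁ τ₂, τ₁ < τ₂ →
      DSVM.IsSwitchingInstant (fun t => D.sigma (u t) (s t)) τ₁ →
      DSVM.IsSwitchingInstant (fun t => D.sigma (u t) (s t)) τ₂ →
      DSVM.IsDissipativeOn V q τ₁ τ₂) ∧
    (∀ τ₁ τ₂, τ₁ < τ₂ →
      DSVM.IsSwitchingInstant (fun t => D.iota (s t)) τ₁ →
      DSVM.IsSwitchingInstant (fun t => D.iota (s t)) τ₂ →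
      DSVM.IsDissipativeOn V q τ₁ τ₂) ∧
    (∀ τ₁ τ₂, τ₁ < τ₂ →
      DSVM.IsSwitchingInstant (fun t => D.rho (s t)) τ₁ →
      DSVM.IsSwitchingInstant (fun t => D.rho (s t)) τ₂ →
      DSVM.IsDissipativeOn V q τ₁ τ₂) ∧
    (∀ T, 0 ≤ T → DSVM.IsDissipativeOn V q 0 T) ∧
    (∀ τ, 0 ≤ τ → Tendsto V (𝓝[>] τ) (𝓝 (V τ))) ∧
    (∀ τ, 0 < τ → ∃ Vminus, Tendsto V (𝓝[<] τ) (𝓝 Vminus) ∧ V τ ≤ Vminus) := by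
  subst hV hq
  have key := fun t₀ t₁ h0 h1 => hs.storage_sub_le hu (a := t₀) (b := t₁) h0 h1
  have hT : ∀ T, 0 ≤ T → DSVM.IsDissipativeOn (fun t => D.storage (u t) (s t))
      (DSVM.supplyRate (fun t => D.output (s t)) u) 0 T := fun T hT =>
    DSVM.isDissipativeOn_of_forall_le le_rfl hT key
  refine ⟨fun t => D.storage_nonneg _ _, ?_, ?_, ?_, hT, fun τ hτ => ?_, fun τ hτ => ?_⟩
  iterate 3
    exact fun τ₁ τ₂ hlt h1 _ => DSVM.isDissipativeOn_of_forall_le h1.1 hlt.le key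
  · exact DSVM.tendsto_right_of_dissipative hτ (lt_add_one τ) (hT _ (by linarith))
      (hs.lowerSemicontinuousWithinAt_storage hu hτ)
  · exact DSVM.exists_tendsto_left_of_dissipative hτ (hT τ hτ.le)
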